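/- Let $k, K$ be positive kernel functions on a set $X$ (functions $X\times X\to\mathbb C$ such that $[k(x_i,x_j)]$ is positive semidefinite for all finite families of points), and let $\mathcal H(k),\mathcal H(K)$ be their reproducing kernel Hilbert spaces of functions on $X$, with kernel vectors $k_x,K_x$, so that $\langle k_x,f\rangle=f(x)$ and $\langle k_x,k_y\rangle=k(x,y)$; inner products and forms are conjugate linear in the first variable. Assume that $\mathfrak q_k(K_x,K_y):=k(x,y)$ is a well-defined sesquilinear form on the linear span $\bigvee_{x}K_x$ in $\mathcal H(K)$, i.e. that $\sum_i c_iK_{x_i}=0$ implies $\sum_i c_ik_{x_i}=0$ for all finite linear combinations. Then $\mathfrak q_k$ is a densely defined, positive semidefinite form in $\mathcal H(K)$. For densely defined positive semidefinite forms write $\mathfrak p\le\mathfrak q$ if $\mathrm{Dom}\,\mathfrak q\subseteq\mathrm{Dom}\,\mathfrak p$ and $\mathfrak p(u,u)\le\mathfrak q(u,u)$ for all $u\in\mathrm{Dom}\,\mathfrak q$. A form $\mathfrak q$ is closed if its domain is complete in the norm $(\|u\|^2+\mathfrak q(u,u))^{1/2}$, closeable if it has a closed extension (its closure $\overline{\mathfrak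 q}$ is the minimal one), and singular if the only closeable form $\mathfrak p\le\mathfrak q$ is identically zero. The Simon--Lebesgue decomposition of $\mathfrak q$ is $\mathfrak q=\mathfrak q_{ac}+\mathfrak q_s$ with $\mathfrak q_{ac},\mathfrak q_s$ forms on $\mathrm{Dom}\,\mathfrak q$, $\mathfrak q_{ac}$ the largest closeable form $\le\mathfrak q$, and $\mathfrak q_s$ singular. For a positive self-adjoint operator $A$, $\mathfrak q_A(u,v):=\langle\sqrt A\,u,\sqrt A\,v\rangle$ on $\mathrm{Dom}\,\mathfrak q_A:=\mathrm{Dom}\,\sqrt A$. **Theorem.** The form $\mathfrak q_k$ has a Simon--Lebesgue decomposition $\mathfrak q_k=\mathfrak q_{ac}+\mathfrak q_s$ in $\mathcal H(K)$, and for this decomposition there are positive kernels $k^{ac},k^s$ on $X$ (for which $\mathfrak q_{k^{ac}},\mathfrak q_{k^s}$ are again well defined on $\bigvee_xK_x$) such that $$\mathfrak q_{ac}=\mathfrak q_{k^{ac}},\qquad \mathfrak q_s=\mathfrak q_{k^s},\qquad k=k^{ac}+k^s,\qquad \mathcal H(k)=\mathcal H(k^{ac})\oplus\mathcal H(k^s),$$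 where the last identity means that both spaces are isometrically contained, as spaces of functions, in $\mathcal H(k)$, are orthogonal there, and together span $\mathcal H(k)$. Moreover $\mathcal H(k^{ac})$ is the closure of $\mathrm{int}(k,K):=\mathcal H(k)\cap\mathcal H(K)$ in the norm of $\mathcal H(k)$. Finally, the embedding $\mathrm e:\mathrm{int}(k,K)\to\mathcal H(K)$, $\mathrm e f=f$, is a densely defined closed operator from this closure to $\mathcal H(K)$, the operator $\mathrm e\mathrm e^*$ is positive and self-adjoint, and $\overline{\mathfrak q_{ac}}=\mathfrak q_{\mathrm e\mathrm e^*}$. -/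

import Mathlib

open Filter Topology
open scoped ComplexOrder

noncomputable section

universe u

/-! ### Positive kernels and their reproducing kernel Hilbert spaces -/

/-- A positive kernel function on a set `X`: a function `k : X × X → ℂ` such that the matrix
`[k (x i) (x j)]` is positive semidefinite for every finite family of points. -/
structure PosKernel (X : Type u) where
  /-- the underlying function of two variables -/
  toFun : X → X → ℂ
  /-- positive semidefiniteness -/
  posSemidef : (Matrix.of toFun).PosSemidef

namespace PosKernel

variable {X : Type u}

instance : CoeFun (PosKernel X) (fun _ => X → X → ℂ) := ⟨PosKernel.toFun⟩

/-- The kernel as an operator valued matrix, with `k x y` acting on `ℂ` by multiplication. -/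
def opMatrix (k : PosKernel X) : Matrix X X (ℂ →L[ℂ] ℂ) :=
  Matrix.of fun x y => k x y • ContinuousLinearMap.id ℂ ℂ

theorem opMatrix_posSemidef (k : PosKernel X) : k.opMatrix.PosSemidef := by
  refine ((RKHS.posSemidef_tfae (K := k.opMatrix)).out 0 2).mpr (And.intro ?_ fun v => ?_)
  · ext x y
    have h := k.posSemidef.1.apply x y
    simp only [Matrix.of_apply] at h
    simp [opMatrix, Matrix.conjTranspose_apply, ← h, star_smul,
      ContinuousLinearMap.star_eq_adjoint, ContinuousLinearMap.adjoint_id]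
  · have h := k.posSemidef.2 v
    refine le_of_le_of_eq (Complex.le_def.mp h).1 ?_
    have hs : ∀ x y, (starRingEnd ℂ) (k x y) = k y x := fun x y => by
      simpa using k.posSemidef.1.apply y x
    simp only [opMatrix, RCLike.inner_apply, Matrix.of_apply, RCLike.re_eq_complex_re]
    simp only [FunLike.coe_smul, Pi.smul_apply, ContinuousLinearMap.id_apply, smul_eq_mul,
      map_mul, hs, Complex.star_def]
    congr 1
    refine Finsupp.sum_congr fun x _ => Finsupp.sum_congr fun y _ => ?_
    ring

instance (k : PosKernel X) : Fact k.opMatrix.PosSemidef := ⟨k.opMatrix_posSemidef⟩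

/-- The reproducing kernel Hilbert space `H(k)`: the Hilbert space of functions on `X` with
reproducing kernel `k`. Elements coerce to functions `X → ℂ`. -/
def H (k : PosKernel X) : Type u := RKHS.OfKernel k.opMatrix

instance (k : PosKernel X) : NormedAddCommGroup k.H :=
  inferInstanceAs (NormedAddCommGroup (RKHS.OfKernel k.opMatrix))

instance (k : PosKernel X) : InnerProductSpace ℂ k.H :=
  inferInstanceAs (InnerProductSpace ℂ (RKHS.OfKernel k.opMatrix))

instance (k : PosKernel X) : CompleteSpace k.H :=
  inferInstanceAs (CompleteSpace (RKHS.OfKernel k.opMatrix))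

instance (k : PosKernel X) : RKHS ℂ k.H X ℂ :=
  inferInstanceAs (RKHS ℂ (RKHS.OfKernel k.opMatrix) X ℂ)

theorem kernel_H (k : PosKernel X) : RKHS.kernel k.H = k.opMatrix :=
  RKHS.OfKernel.kernel_ofKernel

/-- The kernel vector `k_x ∈ H(k)`, i.e. `⟪k_x, f⟫ = f x`. -/
def vec (k : PosKernel X) (x : X) : k.H := RKHS.kerFun k.H x (1 : ℂ)

theorem inner_vec (k : PosKernel X) (x : X) (f : k.H) : inner ℂ (k.vec x) f = f x := by
  simp [vec]

theorem vec_apply (k : PosKernel X) (x y : X) : k.vec y x = k x y := by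
  rw [vec, RKHS.kerFun_apply, kernel_H]
  simp [opMatrix]

theorem inner_vec_vec (k : PosKernel X) (x y : X) : inner ℂ (k.vec x) (k.vec y) = k x y := by
  rw [inner_vec, vec_apply]


/-- The quadratic form of `k` in `H(K)` makes sense: whenever a finite linear combination
`∑ c x • K_x` vanishes, so does `∑ c x • k_x`. This says exactly that `(K_x, K_y) ↦ k x y` extends
to a (necessarily unique) sesquilinear form on the linear span of the vectors `K_x`. -/
def FormDefined (k K : PosKernel X) : Prop :=
  ∀ c : X →₀ ℂ, (∀ y, c.sum (fun x a => a * K y x) = 0) → ∀ y, c.sum (fun x a => a * k y x) = 0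

theorem linearCombination_apply_eq (k : PosKernel X) (c : X →₀ ℂ) (y : X) :
    (Finsupp.linearCombination ℂ k.vec c : k.H) y = c.sum (fun x a => a * k y x) := by
  rw [← inner_vec, Finsupp.linearCombination_apply, Finsupp.sum, inner_sum]
  simp only [inner_smul_right, inner_vec_vec, Finsupp.sum]

theorem FormDefined.ker_le {k K : PosKernel X} (h : k.FormDefined K) :
    LinearMap.ker (Finsupp.linearCombination ℂ K.vec) ≤
      LinearMap.ker (Finsupp.linearCombination ℂ k.vec) := by
  intro c hc
  rw [LinearMap.mem_ker] at hc ⊢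
  refine RKHS.ext fun y => ?_
  rw [linearCombination_apply_eq]
  rw [RKHS.coe_zero]
  refine (h c fun z => ?_) y
  rw [← linearCombination_apply_eq, hc, RKHS.coe_zero, Pi.zero_apply]

/-- The linear span (not closed) of the kernel vectors. -/
def kernelSpan (K : PosKernel X) : Submodule ℂ K.H := Submodule.span ℂ (Set.range K.vec)

theorem vec_mem_kernelSpan (K : PosKernel X) (x : X) : K.vec x ∈ K.kernelSpan :=
  Submodule.subset_span ⟨x, rfl⟩

theorem dense_kernelSpan (K : PosKernel X) : Dense (K.kernelSpan : Set K.H) := by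
  rw [Submodule.dense_iff_topologicalClosure_eq_top, ← Submodule.orthogonal_eq_bot_iff,
    Submodule.eq_bot_iff]
  intro f hf
  refine RKHS.ext fun x => ?_
  rw [← inner_vec, RKHS.coe_zero, Pi.zero_apply]
  exact (Submodule.mem_orthogonal _ _).mp hf _
    (Submodule.le_topologicalClosure _ (K.vec_mem_kernelSpan x))

/-- The linear map `K_x ↦ k_x` on the linear span of the vectors `K_x`. -/
def transfer (k K : PosKernel X) (h : k.FormDefined K) : K.kernelSpan →ₗ[ℂ] k.H :=
  (Submodule.liftQ _ (Finsupp.linearCombination ℂ k.vec) h.ker_le) ∘ₗ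
    (Finsupp.linearCombination ℂ K.vec).quotKerEquivRange.symm.toLinearMap ∘ₗ
      (LinearEquiv.ofEq _ _ (Finsupp.range_linearCombination ℂ).symm).toLinearMap

theorem transfer_vec (k K : PosKernel X) (h : k.FormDefined K) (x : X) :
    transfer k K h ⟨K.vec x, K.vec_mem_kernelSpan x⟩ = k.vec x := by
  have hx : (Finsupp.linearCombination ℂ K.vec).quotKerEquivRange.symm
      ⟨K.vec x, ⟨Finsupp.single x 1, by simp⟩⟩ =
      Submodule.Quotient.mk (Finsupp.single x (1 : ℂ)) := by
    rw [LinearEquiv.symm_apply_eq]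
    apply Subtype.ext
    rw [LinearMap.quotKerEquivRange_apply_mk]
    simp
  change Submodule.liftQ _ (Finsupp.linearCombination ℂ k.vec) h.ker_le
    ((Finsupp.linearCombination ℂ K.vec).quotKerEquivRange.symm _) = _
  refine (congrArg (Submodule.liftQ _ (Finsupp.linearCombination ℂ k.vec) h.ker_le) hx).trans ?_
  rw [Submodule.liftQ_apply]
  simp

end PosKernel

/-! ### Positive quadratic forms -/

section Forms

variable {E : Type u} [NormedAddCommGroup E] [InnerProductSpace ℂ E]

/-- A densely defined, positive semidefinite sesquilinear form in a complex Hilbert space,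
conjugate linear in the first variable. -/
structure PosForm (E : Type u) [NormedAddCommGroup E] [InnerProductSpace ℂ E] where
  /-- the form domain -/
  dom : Submodule ℂ E
  dense_dom : Dense (dom : Set E)
  /-- the form -/
  form : dom →ₗ⋆[ℂ] dom →ₗ[ℂ] ℂ
  nonneg : ∀ x, 0 ≤ form x x

namespace PosForm

/-- The quadratic form `x ↦ q(x, x)`, a nonnegative real number. -/
def quad (q : PosForm E) (x : q.dom) : ℝ := (q.form x x).re

/-- The partial order of forms: `p ≤ q` if `Dom q ⊆ Dom p` and `p(x, x) ≤ q(x, x)` on `Dom q`. -/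
def FormLE (p q : PosForm E) : Prop :=
  ∃ h : q.dom ≤ p.dom, ∀ x : q.dom, p.quad ⟨x, h x.2⟩ ≤ q.quad x

/-- `p` is an extension of `q`. -/
def Extends (p q : PosForm E) : Prop :=
  ∃ h : q.dom ≤ p.dom, ∀ x y : q.dom, p.form ⟨x, h x.2⟩ ⟨y, h y.2⟩ = q.form x y

/-- A form is closed if its domain is complete for the norm `(‖x‖ ^ 2 + q(x, x)) ^ (1 / 2)`. -/
def IsClosedForm (q : PosForm E) : Prop :=
  ∀ u : ℕ → q.dom,
    (∀ ε > 0, ∃ N, ∀ m ≥ N, ∀ n ≥ N, ‖(u m - u n : E)‖ ^ 2 + q.quad (u m - u n) < ε) →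
    ∃ x : q.dom, Tendsto (fun n => ‖(u n - x : E)‖ ^ 2 + q.quad (u n - x)) atTop (𝓝 0)

/-- A form is closeable (absolutely continuous) if it has a closed extension. -/
def Closeable (q : PosForm E) : Prop := ∃ p : PosForm E, p.IsClosedForm ∧ p.Extends q

/-- `p` is the closure of `q`, i.e. its minimal closed extension. -/
def IsClosureOf (p q : PosForm E) : Prop :=
  p.IsClosedForm ∧ p.Extends q ∧ ∀ r : PosForm E, r.IsClosedForm → r.Extends q → r.Extends p

/-- A form is singular if the only closeable form it dominates is identically zero. -/
def Singular (q : PosForm E) : Prop :=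
  ∀ p : PosForm E, p.Closeable → p.FormLE q → ∀ x y : p.dom, p.form x y = 0

/-- `q = p + r` is the Simon--Lebesgue decomposition of `q`: the forms `p` and `r` have the same
domain as `q` and sum up to `q`, the form `p` is the largest closeable form `≤ q`, and `r` is
singular. -/
structure IsSimonLebesgue (q p r : PosForm E) : Prop where
  dom_ac : p.dom = q.dom
  dom_s : r.dom = q.dom
  add : ∀ x y : q.dom, q.form x y =
    p.form ⟨x, dom_ac.ge x.2⟩ ⟨y, dom_ac.ge y.2⟩ + r.form ⟨x, dom_s.ge x.2⟩ ⟨y, dom_s.ge y.2⟩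
  closeable : p.Closeable
  le : p.FormLE q
  maximal : ∀ p' : PosForm E, p'.Closeable → p'.FormLE q → p'.FormLE p
  singular : r.Singular

end PosForm

/-! ### Unbounded operators -/

/-- The composition `g f` of partially defined operators on its natural domain
`{x ∈ Dom f | f x ∈ Dom g}`. -/
def LinearPMap.pcomp {E F G : Type*} [AddCommGroup E] [Module ℂ E] [AddCommGroup F] [Module ℂ F]
    [AddCommGroup G] [Module ℂ G] (g : F →ₗ.[ℂ] G) (f : E →ₗ.[ℂ] F) : E →ₗ.[ℂ] G where
  domain := (g.domain.comap f.toFun).map f.domain.subtype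
  toFun :=
    { toFun := fun x => g ⟨f ⟨x, Submodule.map_subtype_le _ _ x.2⟩, by
          obtain ⟨y, hy, hxy⟩ := x.2
          have : y = ⟨x, Submodule.map_subtype_le _ _ x.2⟩ := Subtype.ext hxy
          exact this ▸ hy⟩
      map_add' := fun x y => 
        (congrArg g (Subtype.ext (f.map_add ⟨x, Submodule.map_subtype_le _ _ x.2⟩
          ⟨y, Submodule.map_subtype_le _ _ y.2⟩))).trans (g.map_add _ _)
      map_smul' := fun c x => 
        (congrArg g (Subtype.ext (f.map_smul c ⟨x, Submodule.map_subtype_le _ _ x.2⟩))).trans (g.map_smul c _) }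

/-- A positive self-adjoint, possibly unbounded, operator. -/
def LinearPMap.IsPosSelfAdjoint [CompleteSpace E] (A : E →ₗ.[ℂ] E) : Prop :=
  IsSelfAdjoint A ∧ ∀ x : A.domain, 0 ≤ inner ℂ (x : E) (A x)

/-- `q` is the form `q_A` of the positive self-adjoint operator `A`: the domain of `q` is the
domain of the positive square root `B = √A` and `q(x, y) = ⟪√A x, √A y⟫`. -/
def PosForm.IsFormOf [CompleteSpace E] (q : PosForm E) (A : E →ₗ.[ℂ] E) : Prop :=
  A.IsPosSelfAdjoint ∧ ∃ B : E →ₗ.[ℂ] E, B.IsPosSelfAdjoint ∧ B.pcomp B = A ∧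
    ∃ h : q.dom = B.domain, ∀ x y : q.dom,
      q.form x y = inner ℂ (B ⟨x, h.le x.2⟩) (B ⟨y, h.le y.2⟩)

end Forms

namespace PosKernel

variable {X : Type u}

/-- The densely defined positive form of `k` in `H(K)`: its domain is the linear span of the
vectors `K_x`, and it takes the value `k x y` at `(K_x, K_y)`. -/
def kernelForm (k K : PosKernel X) (h : k.FormDefined K) : PosForm K.H where
  dom := K.kernelSpan
  dense_dom := K.dense_kernelSpan
  form := LinearMap.mk₂'ₛₗ (starRingEnd ℂ) (RingHom.id ℂ)
    (fun u v => inner ℂ (transfer k K h u) (transfer k K h v))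
    (fun u v w => by rw [map_add, inner_add_left])
    (fun c u v => by rw [map_smul, inner_smul_left, smul_eq_mul])
    (fun u v w => by rw [map_add, inner_add_right])
    (fun c u v => by rw [map_smul, inner_smul_right, RingHom.id_apply, smul_eq_mul])
  nonneg := fun u => by
    rw [LinearMap.mk₂'ₛₗ_apply, inner_self_eq_norm_sq_to_K]
    exact Complex.zero_le_real.mpr (sq_nonneg ‖transfer k K h u‖) |>.trans_eq (by push_cast; rfl)

theorem kernelForm_vec (k K : PosKernel X) (h : k.FormDefined K) (x y : X) :
    (kernelForm k K h).form ⟨K.vec x, K.vec_mem_kernelSpan x⟩ ⟨K.vec y, K.vec_mem_kernelSpan y⟩ =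
      k x y := by
  exact (congrArg₂ (inner ℂ) (transfer_vec k K h x) (transfer_vec k K h y)).trans
    (inner_vec_vec k x y)

/-- The pairs `(f, g) ∈ H(k) × H(K)` such that `f` and `g` are the same function on `X`. -/
def sameFun (k K : PosKernel X) : Submodule ℂ (k.H × K.H) where
  carrier := {p | ∀ x, p.1 x = p.2 x}
  zero_mem' := fun x => by
    rw [Prod.fst_zero, Prod.snd_zero, RKHS.coe_zero, RKHS.coe_zero]
  add_mem' := fun {p r} hp hr x => by
    rw [Prod.fst_add, Prod.snd_add, RKHS.coe_add, RKHS.coe_add, Pi.add_apply, Pi.add_apply,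
      hp x, hr x]
  smul_mem' := fun c p hp x => by
    rw [Prod.smul_fst, Prod.smul_snd, RKHS.coe_smul, RKHS.coe_smul, Pi.smul_apply,
      Pi.smul_apply, hp x]

/-- The intersection space `int(k, K) = H(k) ∩ H(K)`, as a subspace of `H(k)`. -/
def inter (k K : PosKernel X) : Submodule ℂ k.H :=
  (sameFun k K).map (LinearMap.fst ℂ k.H K.H)

/-- The closure of the intersection space in the norm of `H(k)`. -/
def interClosure (k K : PosKernel X) : Submodule ℂ k.H := (inter k K).topologicalClosure

instance (k K : PosKernel X) : CompleteSpace (interClosure k K) :=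
  (inter k K).isClosed_topologicalClosure.completeSpace_coe

/-- The embedding `e : int(k, K) → H(K)`, mapping `f` to the same function `f`, as an operator
from (the closure in `H(k)` of) the intersection space to `H(K)`. -/
def embedding (k K : PosKernel X) : interClosure k K →ₗ.[ℂ] K.H :=
  ((sameFun k K).comap
    ((interClosure k K).subtype.prodMap (LinearMap.id : K.H →ₗ[ℂ] K.H))).toLinearPMap

theorem mem_embedding_domain (k K : PosKernel X) (f : interClosure k K) :
    f ∈ (embedding k K).domain ↔ (f : k.H) ∈ inter k K := by
  constructor
  · rintro ⟨p, hp, rfl⟩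
    exact ⟨(p.1, p.2), hp, rfl⟩
  · rintro ⟨p, hp, hpf⟩
    refine ⟨(f, p.2), fun x => ?_, rfl⟩
    have h1 : p.1 = (f : k.H) := hpf
    have h2 : p.1 x = p.2 x := hp x
    rw [h1] at h2
    exact h2

theorem embedding_apply (k K : PosKernel X) (f : (embedding k K).domain) (x : X) :
    embedding k K f x = (f : k.H) x := by
  have h := Submodule.mem_graph_toLinearPMap (g := (sameFun k K).comap
    ((interClosure k K).subtype.prodMap (LinearMap.id : K.H →ₗ[ℂ] K.H))) (fun p hp hp0 => by
      refine RKHS.ext fun y => ?_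
      have h1 : (p.1 : k.H) y = p.2 y := hp y
      rw [← h1, hp0, Submodule.coe_zero, RKHS.coe_zero, RKHS.coe_zero]) f
  exact (h x).symm

end PosKernel

end

/-!
Let `T` be the operator `K_x ↦ k_x` from `H(K)` to `H(k)`, so that `q_k(u, v) = ⟪T u, T v⟫`. Its
adjoint is the embedding `e` with domain `int(k, K)`. Let `P` be the orthogonal projection onto the
closure of `int(k, K)`. The two parts of `q_k` are the forms of `P T` and of `(1 - P) T`, and their
kernels are `⟪P k_x, P k_y⟫` and `⟪(1 - P) k_x, (1 - P) k_y⟫`.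

The form of `P T` is closeable because `(P T)* = e` is densely defined. A closeable form below the
form of an operator `R` is bounded by `‖f‖²` at `u` whenever `(u, f)` is in the closure of the graph
of `R`. Since that closure contains `(u, P T u)` for `R = T` and `(u, 0)` for `R = (1 - P) T`, the
form of `P T` is the largest closeable form below `q_k`, and the form of `(1 - P) T` is singular.

The closure of the form of `P T` is the form of `(P T)** = e*`. It is the form of `√(e e*)` as well:
for closed `S`, the forms of `S` and of `√(S* S)` agree on the domain of `S* S`, which is a core of
both. The square root is obtained from the bounded operators `(1 + S* S)⁻¹` and `1 - (1 + S* S)⁻¹`.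
-/

theorem tendsto_re_inner_self {V : Type*} [AddCommGroup V] [Module ℂ V]
    (c : PreInnerProductSpace.Core ℂ V) {ι : Type*} {l : Filter ι} {u : ι → V} {x : V}
    (h : Tendsto (fun n => (c.inner (u n - x) (u n - x)).re) l (𝓝 0)) :
    Tendsto (fun n => (c.inner (u n) (u n)).re) l (𝓝 (c.inner x x).re) := by
  let := c
  let : SeminormedAddCommGroup V := InnerProductSpace.Core.toSeminormedAddCommGroup (𝕜 := ℂ)
  have norm_sq (z : V) : (c.inner z z).re = ‖z‖ ^ 2 := (Real.sq_sqrt (c.re_inner_nonneg z)).symm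
  simp only [norm_sq] at h ⊢
  have norm_tendsto : Tendsto (fun n => ‖u n - x‖) l (𝓝 0) := by
    simpa only [Real.sqrt_sq (norm_nonneg _), Real.sqrt_zero] using h.sqrt
  exact (tendsto_iff_norm_sub_tendsto_zero.mpr norm_tendsto).norm.pow 2

namespace PosForm

section Basic

variable {E : Type*} [NormedAddCommGroup E] [InnerProductSpace ℂ E]

theorem quad_nonneg (q : PosForm E) (x : q.dom) : 0 ≤ q.quad x :=
  (Complex.le_def.mp (q.nonneg x)).1

theorem ofReal_quad (q : PosForm E) (x : q.dom) : (q.quad x : ℂ) = q.form x x :=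
  Complex.ext rfl (Complex.le_def.mp (q.nonneg x)).2

theorem form_eq_quad (q : PosForm E) (x y : q.dom) :
    q.form x y = (q.quad (x + y) - q.quad (x - y) - Complex.I * q.quad (x + Complex.I • y) +
      Complex.I * q.quad (x - Complex.I • y)) / 4 := by
  simp only [ofReal_quad, map_add, map_sub, LinearMap.add_apply, LinearMap.sub_apply,
    LinearMap.map_smulₛₗ, map_smul, LinearMap.smul_apply, smul_eq_mul, Complex.conj_I]
  linear_combination (q.form x y - q.form y x) / 2 * Complex.I_sq

theorem conj_form (q : PosForm E) (x y : q.dom) : starRingEnd ℂ (q.form x y) = q.form y x := by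
  have im_form_self (z : q.dom) : (q.form z z).im = 0 := (Complex.le_def.mp (q.nonneg z)).2.symm
  have im_eq := im_form_self (x + y)
  have re_eq := im_form_self (x + Complex.I • y)
  simp only [map_add, LinearMap.add_apply, LinearMap.map_smulₛₗ, map_smul, LinearMap.smul_apply,
    Complex.add_im, smul_eq_mul, Complex.mul_im, Complex.conj_I, Complex.neg_re, Complex.neg_im,
    Complex.I_re, Complex.I_im, im_form_self, Complex.add_re, Complex.mul_re] at im_eq re_eq
  refine Complex.ext ?_ ?_
  · rw [Complex.conj_re]
    linarith
  · rw [Complex.conj_im]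
    linarith

/-- The semi-inner product given by a positive form on its domain. -/
abbrev toCore (q : PosForm E) : PreInnerProductSpace.Core ℂ q.dom where
  inner x y := q.form x y
  conj_inner_symm x y := q.conj_form y x
  re_inner_nonneg := q.quad_nonneg
  add_left x y z := by rw [map_add, LinearMap.add_apply]
  smul_left x y c := by rw [LinearMap.map_smulₛₗ, LinearMap.smul_apply, smul_eq_mul]

theorem tendsto_quad (q : PosForm E) {ι : Type*} {l : Filter ι} {u : ι → q.dom} {x : q.dom}
    (h : Tendsto (fun n => q.quad (u n - x)) l (𝓝 0)) :
    Tendsto (fun n => q.quad (u n)) l (𝓝 (q.quad x)) :=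
  tendsto_re_inner_self q.toCore h

theorem form_eq_zero_of_quad_eq_zero (q : PosForm E) (h : ∀ x, q.quad x = 0) (x y : q.dom) :
    q.form x y = 0 := by
  simp [form_eq_quad, h]

theorem Extends.of_quad {p q : PosForm E} (h : q.dom ≤ p.dom)
    (hpq : ∀ x : q.dom, p.quad ⟨x, h x.2⟩ = q.quad x) : p.Extends q := by
  refine ⟨h, fun x y => ?_⟩
  have hpq' (z : q.dom) : p.quad (Submodule.inclusion h z) = q.quad z := hpq z
  change p.form (Submodule.inclusion h x) (Submodule.inclusion h y) = q.form x y
  simp only [form_eq_quad, ← map_smul, ← map_add, ← map_sub, hpq']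

theorem Extends.quad_eq {p q : PosForm E} (h : p.Extends q) (x : q.dom) :
    p.quad ⟨x, h.1 x.2⟩ = q.quad x :=
  congrArg Complex.re (h.2 x x)

theorem Extends.antisymm {p q : PosForm E} (hpq : p.Extends q) (hqp : q.Extends p) : p = q := by
  obtain ⟨d, hd, f, hf⟩ := p
  obtain ⟨d', hd', f', hf'⟩ := q
  obtain rfl : d = d' := le_antisymm hqp.1 hpq.1
  obtain rfl : f = f' := LinearMap.ext₂ hpq.2
  rfl

theorem ext_of_form {p q : PosForm E} (h : p.dom = q.dom)
    (hf : ∀ x y : q.dom, p.form ⟨x, h.ge x.2⟩ ⟨y, h.ge y.2⟩ = q.form x y) : p = q :=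
  Extends.antisymm ⟨h.ge, hf⟩ ⟨h.le, fun x y => (hf ⟨x, h.le x.2⟩ ⟨y, h.le y.2⟩).symm⟩

theorem FormLE.antisymm {p q : PosForm E} (hpq : p.FormLE q) (hqp : q.FormLE p) : p = q := by
  have hdom : p.dom = q.dom := le_antisymm hqp.1 hpq.1
  exact ext_of_form hdom (Extends.of_quad hdom.ge fun x =>
    le_antisymm (hpq.2 x) (hqp.2 ⟨x, hdom.ge x.2⟩)).2

theorem IsSimonLebesgue.unique {q p r p' r' : PosForm E} (h : q.IsSimonLebesgue p r)
    (h' : q.IsSimonLebesgue p' r') : p = p' ∧ r = r' := by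
  obtain rfl : p = p' := (h'.maximal p h.closeable h.le).antisymm (h.maximal p' h'.closeable h'.le)
  refine ⟨rfl, ext_of_form (h.dom_s.trans h'.dom_s.symm) fun x y => ?_⟩
  have add_eq := (h.add ⟨x, h'.dom_s.le x.2⟩ ⟨y, h'.dom_s.le y.2⟩).symm.trans
    (h'.add ⟨x, h'.dom_s.le x.2⟩ ⟨y, h'.dom_s.le y.2⟩)
  exact add_left_cancel add_eq

theorem IsClosureOf.unique {p p' q : PosForm E} (h : p.IsClosureOf q) (h' : p'.IsClosureOf q) :
    p = p' :=
  (h'.2.2 p h.1 h.2.1).antisymm (h.2.2 p' h'.1 h'.2.1)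

theorem isClosedForm_iff {q : PosForm E} :
    q.IsClosedForm ↔ ∀ u : ℕ → q.dom,
      Tendsto (fun n : ℕ × ℕ => ‖(u n.1 - u n.2 : E)‖ ^ 2 + q.quad (u n.1 - u n.2)) atTop (𝓝 0) →
        ∃ x : q.dom, Tendsto (fun n => ‖(u n - x : E)‖ ^ 2 + q.quad (u n - x)) atTop (𝓝 0) := by
  refine forall_congr' fun u => imp_congr_left ?_
  have nonneg (x : q.dom) : 0 ≤ ‖(x : E)‖ ^ 2 + q.quad x :=
    add_nonneg (sq_nonneg _) (q.quad_nonneg x)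
  rw [← prod_atTop_atTop_eq, atTop_basis.prod_self.tendsto_iff Metric.nhds_basis_ball]
  simp only [Set.mem_prod, Set.mem_Ici, Prod.forall, and_imp, true_and, ge_iff_le, gt_iff_lt,
    Metric.mem_ball, Real.dist_0_eq_abs]
  refine forall₂_congr fun ε _ => exists_congr fun N => ?_
  have abs_eq (m n : ℕ) := abs_of_nonneg (nonneg (u m - u n))
  simp only [Submodule.coe_sub] at abs_eq
  simp only [abs_eq]
  exact ⟨fun h m n hm hn => h m hm n hn, fun h m hm n hn => h m n hm hn⟩

theorem IsClosedForm.exists_tendsto_quad {p : PosForm E} (hp : p.IsClosedForm) {w : ℕ → p.dom}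
    {u : E} (hu : Tendsto (fun n => (w n : E)) atTop (𝓝 u))
    (hw : Tendsto (fun n : ℕ × ℕ => p.quad (w n.1 - w n.2)) atTop (𝓝 0)) :
    ∃ h : u ∈ p.dom, Tendsto (fun n => p.quad (w n)) atTop (𝓝 (p.quad ⟨u, h⟩)) := by
  have cauchy := (cauchySeq_iff_tendsto_dist_atTop_0.mp hu.cauchySeq).pow 2
  simp only [dist_eq_norm] at cauchy
  obtain ⟨x, hx⟩ := isClosedForm_iff.mp hp w <| by simpa using cauchy.add hw
  have norm_sq_tendsto : Tendsto (fun n => ‖(w n - x : E)‖ ^ 2) atTop (𝓝 0) :=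
    squeeze_zero (fun _ => by positivity) (fun n => le_add_of_nonneg_right (p.quad_nonneg _)) hx
  have quad_tendsto : Tendsto (fun n => p.quad (w n - x)) atTop (𝓝 0) :=
    squeeze_zero (fun _ => p.quad_nonneg _) (fun n => le_add_of_nonneg_left (by positivity)) hx
  have norm_tendsto : Tendsto (fun n => ‖(w n - x : E)‖) atTop (𝓝 0) := by
    simpa only [Real.sqrt_sq (norm_nonneg _), Real.sqrt_zero] using norm_sq_tendsto.sqrt
  obtain rfl : u = x := tendsto_nhds_unique hu (tendsto_iff_norm_sub_tendsto_zero.mpr norm_tendsto)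
  exact ⟨x.2, p.tendsto_quad quad_tendsto⟩

end Basic

end PosForm

theorem cauchySeq_of_norm_sub_sq_le {V : Type*} [SeminormedAddCommGroup V] {v : ℕ → V}
    {b : ℕ × ℕ → ℝ} (hv : ∀ n, ‖v n.1 - v n.2‖ ^ 2 ≤ b n) (hb : Tendsto b atTop (𝓝 0)) :
    CauchySeq v := by
  have := (squeeze_zero (fun _ => sq_nonneg _) hv hb).sqrt
  simp only [Real.sqrt_sq (norm_nonneg _), Real.sqrt_zero] at this
  simpa only [cauchySeq_iff_tendsto_dist_atTop_0, dist_eq_norm] using this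

namespace PosForm

section OfOp

variable {E F : Type*} [NormedAddCommGroup E] [InnerProductSpace ℂ E]
  [NormedAddCommGroup F] [InnerProductSpace ℂ F]

/-- The form `(u, v) ↦ ⟪T u, T v⟫` of a densely defined operator `T`. -/
noncomputable def ofOp (T : E →ₗ.[ℂ] F) (hT : Dense (T.domain : Set E)) : PosForm E where
  dom := T.domain
  dense_dom := hT
  form := LinearMap.mk₂'ₛₗ (starRingEnd ℂ) (RingHom.id ℂ)
    (fun u v => inner ℂ (T u) (T v))
    (fun u v w => by rw [T.map_add, inner_add_left])
    (fun c u v => by rw [T.map_smul, inner_smul_left, smul_eq_mul])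
    (fun u v w => by rw [T.map_add, inner_add_right])
    (fun c u v => by rw [T.map_smul, inner_smul_right, RingHom.id_apply, smul_eq_mul])
  nonneg := fun u => by
    rw [LinearMap.mk₂'ₛₗ_apply, inner_self_eq_norm_sq_to_K]
    exact (Complex.zero_le_real.mpr (sq_nonneg ‖T u‖)).trans_eq (Complex.ofReal_pow _ _)

theorem quad_ofOp (T : E →ₗ.[ℂ] F) (hT : Dense (T.domain : Set E)) (u : T.domain) :
    (ofOp T hT).quad u = ‖T u‖ ^ 2 :=
  inner_self_eq_norm_sq (𝕜 := ℂ) (T u)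

theorem quad_ofOp_sub (T : E →ₗ.[ℂ] F) (hT : Dense (T.domain : Set E)) (u v : T.domain) :
    (ofOp T hT).quad (u - v) = ‖T u - T v‖ ^ 2 := by
  rw [← T.map_sub]
  exact quad_ofOp T hT (u - v)

theorem isClosedForm_ofOp [CompleteSpace E] [CompleteSpace F] {T : E →ₗ.[ℂ] F} (hT : T.IsClosed)
    (hdense : Dense (T.domain : Set E)) : (ofOp T hdense).IsClosedForm := by
  refine isClosedForm_iff.mpr fun u hu => ?_
  obtain ⟨x, hx⟩ := cauchySeq_tendsto_of_complete <| cauchySeq_of_norm_sub_sq_le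
    (v := fun n => (u n : E)) (fun n => le_add_of_nonneg_right (quad_nonneg _ _)) hu
  obtain ⟨y, hy⟩ := cauchySeq_tendsto_of_complete <| cauchySeq_of_norm_sub_sq_le
    (v := fun n => T (u n)) (fun n => (quad_ofOp_sub T hdense (u n.1) (u n.2)).ge.trans
      (le_add_of_nonneg_left (sq_nonneg _))) hu
  have mem_graph : (x, y) ∈ T.graph :=
    hT.mem_of_tendsto (hx.prodMk_nhds hy) (Eventually.of_forall fun n => T.mem_graph (u n))
  obtain ⟨z, rfl, rfl⟩ := (LinearPMap.mem_graph_iff T).mp mem_graph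
  have := ((tendsto_iff_norm_sub_tendsto_zero.mp hx).pow 2).add
    ((tendsto_iff_norm_sub_tendsto_zero.mp hy).pow 2)
  rw [zero_pow two_ne_zero, add_zero] at this
  exact ⟨z, this.congr fun n => congrArg _ (quad_ofOp_sub T hdense (u n) z).symm⟩

theorem exists_seq_of_mem_closure_graph {T : E →ₗ.[ℂ] F} {u : E} {f : F}
    (h : (u, f) ∈ T.graph.topologicalClosure) :
    ∃ w : ℕ → T.domain, Tendsto (fun n => (w n : E)) atTop (𝓝 u) ∧
      Tendsto (fun n => T (w n)) atTop (𝓝 f) := by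
  obtain ⟨p, hp, hlim⟩ := mem_closure_iff_seq_limit.mp h
  choose w hw₁ hw₂ using fun n => (LinearPMap.mem_graph_iff T).mp (hp n)
  refine ⟨w, ?_, ?_⟩
  · simpa only [hw₁] using hlim.fst_nhds
  · simpa only [hw₂] using hlim.snd_nhds

theorem IsClosedForm.exists_tendsto_quad_of_formLE {T : E →ₗ.[ℂ] F}
    {hT : Dense (T.domain : Set E)} {r : PosForm E} (hr : r.IsClosedForm)
    (hle : r.FormLE (ofOp T hT)) {w : ℕ → T.domain} {u : E} {f : F}
    (hw : Tendsto (fun n => (w n : E)) atTop (𝓝 u))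
    (hTw : Tendsto (fun n => T (w n)) atTop (𝓝 f)) :
    ∃ h : u ∈ r.dom,
      Tendsto (fun n => r.quad ⟨w n, hle.1 (w n).2⟩) atTop (𝓝 (r.quad ⟨u, h⟩)) := by
  refine hr.exists_tendsto_quad hw ?_
  have quad_ofOp_tendsto := (cauchySeq_iff_tendsto_dist_atTop_0.mp hTw.cauchySeq).pow 2
  simp only [dist_eq_norm, ne_eq, OfNat.ofNat_ne_zero, not_false_eq_true, zero_pow]
    at quad_ofOp_tendsto
  exact squeeze_zero (fun _ => r.quad_nonneg _) (fun n => (hle.2 (w n.1 - w n.2)).trans_eq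
    (quad_ofOp_sub T hT (w n.1) (w n.2))) quad_ofOp_tendsto

theorem Closeable.quad_le_of_mem_closure_graph {T : E →ₗ.[ℂ] F} {hT : Dense (T.domain : Set E)}
    {p : PosForm E} (hp : p.Closeable) (hle : p.FormLE (ofOp T hT)) {u : p.dom} {f : F}
    (h : ((u : E), f) ∈ T.graph.topologicalClosure) : p.quad u ≤ ‖f‖ ^ 2 := by
  obtain ⟨r, hr, hrp⟩ := hp
  obtain ⟨w, hw, hTw⟩ := exists_seq_of_mem_closure_graph h
  have quad_le (v : T.domain) : r.quad ⟨v, hrp.1 (hle.1 v.2)⟩ ≤ ‖T v‖ ^ 2 :=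
    ((hrp.quad_eq ⟨v, hle.1 v.2⟩).trans_le (hle.2 v)).trans_eq (quad_ofOp T hT v)
  obtain ⟨_, hlim⟩ := hr.exists_tendsto_quad_of_formLE
    ⟨hle.1.trans hrp.1, fun v => (quad_le v).trans_eq (quad_ofOp T hT v).symm⟩ hw hTw
  rw [← hrp.quad_eq]
  exact le_of_tendsto_of_tendsto' hlim (hTw.norm.pow 2) fun n => quad_le (w n)

theorem ofOp_extends {S T : E →ₗ.[ℂ] F} (hS : Dense (S.domain : Set E))
    (hT : Dense (T.domain : Set E)) (h : T ≤ S) : (ofOp S hS).Extends (ofOp T hT) :=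
  ⟨h.1, fun x y => (congrArg₂ (inner ℂ) (@h.2 x ⟨x, h.1 x.2⟩ rfl)
    (@h.2 y ⟨y, h.1 y.2⟩ rfl)).symm⟩

theorem isClosureOf_ofOp [CompleteSpace E] [CompleteSpace F] {S T : E →ₗ.[ℂ] F}
    (hS : Dense (S.domain : Set E)) (hT : Dense (T.domain : Set E))
    (h : S.graph = T.graph.topologicalClosure) : (ofOp S hS).IsClosureOf (ofOp T hT) := by
  have closed : S.IsClosed := by
    rw [LinearPMap.IsClosed, h]
    exact T.graph.isClosed_topologicalClosure
  have le : T ≤ S := LinearPMap.le_of_le_graph (h ▸ T.graph.le_topologicalClosure)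
  refine ⟨isClosedForm_ofOp closed hS, ofOp_extends hS hT le, fun r hr hrT => ?_⟩
  have exists_quad_eq (u : S.domain) :
      ∃ h : (u : E) ∈ r.dom, r.quad ⟨u, h⟩ = (ofOp S hS).quad u := by
    obtain ⟨w, hw, hTw⟩ := exists_seq_of_mem_closure_graph (h ▸ S.mem_graph u)
    obtain ⟨hu, hlim⟩ := hr.exists_tendsto_quad_of_formLE
      ⟨hrT.1, fun v => (hrT.quad_eq v).le⟩ hw hTw
    refine ⟨hu, tendsto_nhds_unique hlim ?_⟩
    rw [quad_ofOp]
    exact (hTw.norm.pow 2).congr fun n => ((hrT.quad_eq (w n)).trans (quad_ofOp T hT (w n))).symm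
  exact Extends.of_quad (fun u hu => (exists_quad_eq ⟨u, hu⟩).1) fun u => (exists_quad_eq u).2

end OfOp

end PosForm

open LinearPMap (mem_graph_iff eq_of_eq_graph mem_domain_of_mem_graph isSelfAdjoint_def
  adjoint_graph_eq_graph_adjoint)

section DoubleAdjoint

variable {E F : Type*} [NormedAddCommGroup E] [InnerProductSpace ℂ E]
  [NormedAddCommGroup F] [InnerProductSpace ℂ F]

/-- A subspace of `E × F`, such as the graph of an operator, as a subspace of the Hilbert sum of
`E` and `F`. -/
def hilbertSumSubmodule (g : Submodule ℂ (E × F)) : Submodule ℂ (WithLp 2 (E × F)) :=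
  g.comap (WithLp.prodContinuousLinearEquiv 2 ℂ E F).toLinearEquiv.toLinearMap

theorem mem_orthogonal_hilbertSumSubmodule {g : Submodule ℂ (E × F)} {p : WithLp 2 (E × F)} :
    p ∈ (hilbertSumSubmodule g)ᗮ ↔ (p.snd, -p.fst) ∈ g.adjoint := by
  simp only [Submodule.mem_adjoint_iff, Submodule.mem_orthogonal, WithLp.prod_inner_apply,
    inner_neg_right, sub_neg_eq_add]
  exact ⟨fun h a b hab => (add_comm _ _).trans (h (WithLp.toLp 2 (a, b)) hab),
    fun h q hq => (add_comm _ _).trans (h _ _ hq)⟩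

theorem adjoint_adjoint_eq_topologicalClosure [CompleteSpace E] [CompleteSpace F]
    (g : Submodule ℂ (E × F)) : g.adjoint.adjoint = g.topologicalClosure := by
  ext ⟨u, f⟩
  have mem_closure_iff : (u, f) ∈ g.topologicalClosure ↔
      WithLp.toLp 2 (u, f) ∈ (hilbertSumSubmodule g).topologicalClosure :=
    Set.ext_iff.mp ((WithLp.prodContinuousLinearEquiv 2 ℂ E F).toHomeomorph.preimage_closure
      (g : Set (E × F))) (WithLp.toLp 2 (u, f))
  rw [mem_closure_iff, ← Submodule.orthogonal_orthogonal_eq_closure, Submodule.mem_orthogonal,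
    Submodule.mem_adjoint_iff]
  simp only [mem_orthogonal_hilbertSumSubmodule, WithLp.prod_inner_apply]
  constructor
  · intro h p hp
    have := h _ _ hp
    rw [inner_neg_left] at this
    exact neg_eq_zero.mp ((neg_add' _ _).trans this)
  · intro h b a hba
    have := h (WithLp.toLp 2 (-a, b)) (by simpa using hba)
    rw [inner_neg_left] at this
    linear_combination -this

theorem adjoint_graph_adjoint [CompleteSpace E] [CompleteSpace F] {T : E →ₗ.[ℂ] F}
    (hT : Dense (T.domain : Set E)) : T.adjoint.graph.adjoint = T.graph.topologicalClosure := by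
  rw [adjoint_graph_eq_graph_adjoint hT, adjoint_adjoint_eq_topologicalClosure]

theorem adjoint_adjoint_graph [CompleteSpace E] [CompleteSpace F] {T : E →ₗ.[ℂ] F}
    (hT : Dense (T.domain : Set E)) (hT' : Dense (T.adjoint.domain : Set F)) :
    T.adjoint.adjoint.graph = T.graph.topologicalClosure := by
  rw [adjoint_graph_eq_graph_adjoint hT', adjoint_graph_adjoint hT]

theorem mem_closure_graph_iff [CompleteSpace E] [CompleteSpace F] {T : E →ₗ.[ℂ] F}
    (hT : Dense (T.domain : Set E)) {u : E} {f : F} :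
    (u, f) ∈ T.graph.topologicalClosure ↔
      ∀ b : T.adjoint.domain, inner ℂ (T.adjoint b) u = inner ℂ (b : F) f := by
  rw [← adjoint_graph_adjoint hT, Submodule.mem_adjoint_iff]
  simp only [sub_eq_zero, mem_graph_iff]
  exact ⟨fun h b => h _ _ ⟨b, rfl, rfl⟩, by rintro h _ _ ⟨b, rfl, rfl⟩; exact h b⟩

theorem dense_domain_adjoint [CompleteSpace E] [CompleteSpace F] {T : E →ₗ.[ℂ] F}
    (hT : Dense (T.domain : Set E)) (hc : T.IsClosed) : Dense (T.adjoint.domain : Set F) := by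
  rw [Submodule.dense_iff_topologicalClosure_eq_top, Submodule.topologicalClosure_eq_top_iff,
    Submodule.eq_bot_iff]
  intro f hf
  have : ((0 : E), f) ∈ T.graph.topologicalClosure := (mem_closure_graph_iff hT).mpr fun b => by
    rw [inner_zero_right]
    exact ((Submodule.mem_orthogonal _ _).mp hf b b.2).symm
  rw [hc.submodule_topologicalClosure_eq] at this
  exact T.graph_fst_eq_zero_snd this rfl

theorem adjoint_adjoint_eq_self [CompleteSpace E] [CompleteSpace F] {T : E →ₗ.[ℂ] F}
    (hT : Dense (T.domain : Set E)) (hc : T.IsClosed) : T.adjoint.adjoint = T :=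
  eq_of_eq_graph <| (adjoint_adjoint_graph hT (dense_domain_adjoint hT hc)).trans
    hc.submodule_topologicalClosure_eq

end DoubleAdjoint

section Composition

theorem mem_graph_pcomp {E F G : Type*} [AddCommGroup E] [Module ℂ E] [AddCommGroup F] [Module ℂ F]
    [AddCommGroup G] [Module ℂ G] (g : F →ₗ.[ℂ] G) (f : E →ₗ.[ℂ] F) {x : E} {z : G} :
    (x, z) ∈ (g.pcomp f).graph ↔ ∃ y, (x, y) ∈ f.graph ∧ (y, z) ∈ g.graph := by
  constructor
  · intro h
    obtain ⟨⟨x, hx⟩, rfl, rfl⟩ := (mem_graph_iff _).mp h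
    exact ⟨f ⟨x, Submodule.map_subtype_le _ _ hx⟩, f.mem_graph ⟨x, _⟩, g.mem_graph ⟨_, _⟩⟩
  · rintro ⟨y, hxy, hyz⟩
    obtain ⟨x, rfl, rfl⟩ := (mem_graph_iff _).mp hxy
    obtain ⟨y, hy : (y : F) = f x, rfl⟩ := (mem_graph_iff _).mp hyz
    exact (mem_graph_iff _).mpr ⟨⟨x, ⟨x, (hy ▸ y.2 : f x ∈ g.domain), rfl⟩⟩, rfl,
      congrArg g (Subtype.ext hy.symm)⟩

end Composition

section QuotientOp

variable {E : Type*} [NormedAddCommGroup E] [InnerProductSpace ℂ E] {U W : E →L[ℂ] E}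

/-- The operator `W U⁻¹` on the range of `U`, for bounded `U` and `W` with `U` injective. -/
noncomputable def quotientOp (U W : E →L[ℂ] E) : E →ₗ.[ℂ] E :=
  (LinearMap.range (U.prod W).toLinearMap).toLinearPMap

theorem mem_graph_quotientOp (hU : Function.Injective U) {x z : E} :
    (x, z) ∈ (quotientOp U W).graph ↔ ∃ w, U w = x ∧ W w = z := by
  rw [quotientOp, Submodule.toLinearPMap_graph_eq]
  · simp only [LinearMap.mem_range, ContinuousLinearMap.coe_coe, ContinuousLinearMap.prod_apply,
      Prod.mk.injEq]
  · rintro _ ⟨w, rfl⟩ hw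
    rw [(map_eq_zero_iff U hU).mp hw, map_zero, Prod.snd_zero]

theorem dense_domain_quotientOp [CompleteSpace E] (hU : Function.Injective U)
    (hU' : IsSelfAdjoint U) : Dense ((quotientOp U W).domain : Set E) := by
  rw [Submodule.dense_iff_topologicalClosure_eq_top, Submodule.topologicalClosure_eq_top_iff,
    Submodule.eq_bot_iff]
  intro x hx
  refine (map_eq_zero_iff U hU).mp (ext_inner_left ℂ fun w => ?_)
  refine (hU'.isSymmetric w x).symm.trans (.trans ?_ (inner_zero_right _).symm)
  exact (Submodule.mem_orthogonal _ _).mp hx _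
    (mem_domain_of_mem_graph ((mem_graph_quotientOp hU).mpr ⟨w, rfl, rfl⟩))

/-- `hmax` says that the graph is maximal among the symmetric ones. -/
theorem isSelfAdjoint_quotientOp [CompleteSpace E] (hU : Function.Injective U)
    (hU' : IsSelfAdjoint U) (hW : IsSelfAdjoint W) (hUW : Commute U W)
    (hmax : ∀ y z, W y = U z → ∃ w, U w = y ∧ W w = z) : IsSelfAdjoint (quotientOp U W) := by
  rw [isSelfAdjoint_def]
  refine eq_of_eq_graph ?_
  ext ⟨y, z⟩
  rw [adjoint_graph_eq_graph_adjoint (dense_domain_quotientOp hU hU'), Submodule.mem_adjoint_iff,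
    mem_graph_quotientOp hU]
  simp only [mem_graph_quotientOp hU, sub_eq_zero]
  constructor
  · intro h
    refine hmax y z (ext_inner_left ℂ fun w => ?_)
    exact (hW.isSymmetric w y).symm.trans
      ((h _ _ ⟨w, rfl, rfl⟩).trans (hU'.isSymmetric w z))
  · rintro ⟨w, rfl, rfl⟩ _ _ ⟨v, rfl, rfl⟩
    refine (hW.isSymmetric v (U w)).trans (.trans ?_ (hU'.isSymmetric v (W w)).symm)
    exact congrArg (inner ℂ v) (DFunLike.congr_fun hUW.eq w).symm

theorem isPosSelfAdjoint_quotientOp [CompleteSpace E] (hU : Function.Injective U)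
    (hU' : 0 ≤ U) (hW : 0 ≤ W) (hUW : Commute U W)
    (hmax : ∀ y z, W y = U z → ∃ w, U w = y ∧ W w = z) : (quotientOp U W).IsPosSelfAdjoint := by
  refine ⟨isSelfAdjoint_quotientOp hU hU'.isSelfAdjoint hW.isSelfAdjoint hUW hmax, fun x => ?_⟩
  obtain ⟨w, hw, hw'⟩ := (mem_graph_quotientOp hU).mp ((quotientOp U W).mem_graph x)
  rw [← hw, ← hw']
  exact (((ContinuousLinearMap.nonneg_iff_isPositive _).mp
    (Commute.mul_nonneg hU' hW hUW)).inner_nonneg_right w).trans_eq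
      (hU'.isSelfAdjoint.isSymmetric w (W w)).symm

theorem quotientOp_pcomp_self (hU : Function.Injective U) (hUW : Commute U W)
    (hone : U * U + W * W = 1) :
    (quotientOp U W).pcomp (quotientOp U W) = quotientOp (U * U) (W * W) := by
  have hUU : Function.Injective (U * U) := hU.comp hU
  have comm (x : E) : U (W x) = W (U x) := DFunLike.congr_fun hUW.eq x
  have add_eq (x : E) : U (U x) + W (W x) = x := DFunLike.congr_fun hone x
  refine eq_of_eq_graph ?_
  ext ⟨x, z⟩
  rw [mem_graph_pcomp, mem_graph_quotientOp hUU]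
  simp only [mem_graph_quotientOp hU]
  constructor
  · rintro ⟨_, ⟨a, rfl, rfl⟩, b, hb, rfl⟩
    refine ⟨U a + W b, ?_, ?_⟩
    · change U (U (U a + W b)) = U a
      rw [map_add, comm b, hb, add_eq]
    · change W (W (U a + W b)) = W b
      rw [map_add, ← comm a, ← hb, add_eq]
  · rintro ⟨w, rfl, rfl⟩
    exact ⟨W (U w), ⟨U w, rfl, rfl⟩, W w, comm w, rfl⟩

theorem exists_sqrt_quotientOp [CompleteSpace E] {R V : E →L[ℂ] E} (hR : Function.Injective R)
    (hR' : 0 ≤ R) (hV : 0 ≤ V) (hRV : R + V = 1) :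
    (quotientOp R V).IsPosSelfAdjoint ∧
      ∃ B : E →ₗ.[ℂ] E, B.IsPosSelfAdjoint ∧ B.pcomp B = quotientOp R V := by
  have comm : Commute R V := by
    rw [← eq_sub_iff_add_eq'] at hRV
    rw [hRV]
    exact (Commute.one_right R).sub_right (Commute.refl R)
  have sqrt_comm : Commute (CFC.sqrt R) (CFC.sqrt V) :=
    ((comm.cfcₙ_nnreal _).symm.cfcₙ_nnreal _).symm
  have sqrt_mul_R := CFC.sqrt_mul_sqrt_self R hR'
  have sqrt_mul_V := CFC.sqrt_mul_sqrt_self V hV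
  have sqrt_inj : Function.Injective (CFC.sqrt R : E →L[ℂ] E) := by
    rw [← sqrt_mul_R] at hR
    exact .of_comp hR
  have sqrt_add : CFC.sqrt R * CFC.sqrt R + CFC.sqrt V * CFC.sqrt V = 1 := by
    rw [sqrt_mul_R, sqrt_mul_V, hRV]
  have add_eq (x : E) : R x + V x = x := DFunLike.congr_fun hRV x
  have sqrt_add_eq (x : E) :
      CFC.sqrt R (CFC.sqrt R x) + CFC.sqrt V (CFC.sqrt V x) = x := DFunLike.congr_fun sqrt_add x
  have sqrt_comm_eq (x : E) : CFC.sqrt R (CFC.sqrt V x) = CFC.sqrt V (CFC.sqrt R x) :=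
    DFunLike.congr_fun sqrt_comm.eq x
  refine ⟨isPosSelfAdjoint_quotientOp hR hR' hV comm fun y z h => ⟨y + z, ?_, ?_⟩,
    quotientOp (CFC.sqrt R) (CFC.sqrt V), isPosSelfAdjoint_quotientOp sqrt_inj
      (CFC.sqrt_nonneg R) (CFC.sqrt_nonneg V) sqrt_comm fun y z h =>
        ⟨CFC.sqrt R y + CFC.sqrt V z, ?_, ?_⟩, ?_⟩
  · rw [map_add, ← h, add_eq]
  · rw [map_add, h, add_eq]
  · rw [map_add, sqrt_comm_eq, ← h, sqrt_add_eq]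
  · rw [map_add, ← sqrt_comm_eq, h, sqrt_add_eq]
  · rw [quotientOp_pcomp_self sqrt_inj sqrt_comm sqrt_add, sqrt_mul_R, sqrt_mul_V]

end QuotientOp

section VonNeumann

variable {E F G : Type*} [NormedAddCommGroup E] [InnerProductSpace ℂ E]
  [NormedAddCommGroup F] [InnerProductSpace ℂ F]
  [NormedAddCommGroup G] [InnerProductSpace ℂ G] {S : E →ₗ.[ℂ] F}

theorem self_comp_adjoint_le_one [CompleteSpace E] [CompleteSpace F] {g : F →L[ℂ] E}
    (hg : ‖g‖ ≤ 1) : g ∘L g.adjoint ≤ 1 := by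
  have norm_adjoint : ‖g.adjoint‖ = ‖g‖ :=
    LinearIsometryEquiv.norm_map ContinuousLinearMap.adjoint g
  have nonneg : 0 ≤ g ∘L g.adjoint := (ContinuousLinearMap.nonneg_iff_isPositive _).mpr
    (ContinuousLinearMap.isPositive_self_comp_adjoint g)
  refine (CStarAlgebra.norm_le_one_iff_of_nonneg _ nonneg).mp ?_
  calc ‖g ∘L g.adjoint‖ ≤ ‖g‖ * ‖g.adjoint‖ := ContinuousLinearMap.opNorm_comp_le _ _
    _ ≤ 1 := mul_le_one₀ hg (norm_nonneg _) (norm_adjoint.trans_le hg)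

/-- The first projection on the graph of `S`, as a contraction from the Hilbert space obtained by
giving the graph the norm `(‖x‖ ^ 2 + ‖S x‖ ^ 2) ^ (1 / 2)`. -/
noncomputable def graphFst (S : E →ₗ.[ℂ] F) : hilbertSumSubmodule S.graph →L[ℂ] E :=
  WithLp.fstL 2 ℂ E F ∘L (hilbertSumSubmodule S.graph).subtypeL

theorem graphFst_injective (S : E →ₗ.[ℂ] F) : Function.Injective (graphFst S) := by
  refine (injective_iff_map_eq_zero _).mpr fun p hp => Subtype.ext ?_
  exact (WithLp.equiv 2 (E × F)).injective (Prod.ext hp (S.graph_fst_eq_zero_snd p.2 hp))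

theorem denseRange_graphFst (hd : Dense (S.domain : Set E)) : DenseRange (graphFst S) :=
  hd.mono fun x hx => ⟨⟨WithLp.toLp 2 (x, S ⟨x, hx⟩), S.mem_graph ⟨x, hx⟩⟩, rfl⟩

theorem norm_graphFst_le (S : E →ₗ.[ℂ] F) : ‖graphFst S‖ ≤ 1 := by
  refine ContinuousLinearMap.opNorm_le_bound _ zero_le_one fun p => ?_
  rw [one_mul]
  exact WithLp.norm_fst_le _ _

variable [CompleteSpace E]

theorem inner_eq_of_mem_graph_adjoint_pcomp_self (hd : Dense (S.domain : Set E)) {x : S.domain}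
    {z : E} (h : ((x : E), z) ∈ (S.adjoint.pcomp S).graph) (y : S.domain) :
    inner ℂ (S x) (S y) = inner ℂ z (y : E) := by
  obtain ⟨v, hxv, hvz⟩ := (mem_graph_pcomp _ _).mp h
  obtain ⟨v, rfl, rfl⟩ := (mem_graph_iff _).mp hvz
  rw [LinearPMap.mem_graph_snd_inj S (S.mem_graph x) hxv rfl]
  exact (LinearPMap.adjoint_isFormalAdjoint hd v y).symm

theorem domain_adjoint_pcomp_self_le : (S.adjoint.pcomp S).domain ≤ S.domain :=
  Submodule.map_subtype_le _ _

theorem completeSpace_hilbertSumSubmodule [CompleteSpace F] (hS : S.IsClosed) :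
    CompleteSpace (hilbertSumSubmodule S.graph) :=
  (hS.preimage (WithLp.prodContinuousLinearEquiv 2 ℂ E F).continuous).completeSpace_coe

section Resolvent

variable [CompleteSpace (hilbertSumSubmodule S.graph)]

/-- The bounded operator `(1 + S* S)⁻¹`. -/
noncomputable def graphResolvent (S : E →ₗ.[ℂ] F) [CompleteSpace (hilbertSumSubmodule S.graph)] :
    E →L[ℂ] E :=
  graphFst S ∘L (graphFst S).adjoint

theorem adjoint_graphFst_eq_iff (hd : Dense (S.domain : Set E)) {w : E}
    {p : hilbertSumSubmodule S.graph} :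
    (graphFst S).adjoint w = p ↔ (p.1.snd, w - p.1.fst) ∈ S.adjoint.graph := by
  have inner_adjoint (q : hilbertSumSubmodule S.graph) :
      inner ℂ q ((graphFst S).adjoint w) = inner ℂ q.1.fst w :=
    ContinuousLinearMap.adjoint_inner_right _ _ _
  have inner_eq_add (q : hilbertSumSubmodule S.graph) :
      inner ℂ q p = inner ℂ q.1.fst p.1.fst + inner ℂ q.1.snd p.1.snd := rfl
  have eq_iff : (graphFst S).adjoint w = p ↔ ∀ q : hilbertSumSubmodule S.graph,
      inner ℂ q.1.fst w = inner ℂ q.1.fst p.1.fst + inner ℂ q.1.snd p.1.snd := by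
    simp only [← inner_adjoint, ← inner_eq_add]
    exact ⟨fun h q => h ▸ rfl, fun h => ext_inner_left ℂ h⟩
  rw [eq_iff, adjoint_graph_eq_graph_adjoint hd, Submodule.mem_adjoint_iff]
  simp only [inner_sub_right]
  constructor
  · intro h a b hab
    have inner_eq := h ⟨WithLp.toLp 2 (a, b), hab⟩
    simp only [WithLp.toLp_fst, WithLp.toLp_snd] at inner_eq
    linear_combination -inner_eq
  · intro h q
    linear_combination -h q.1.fst q.1.snd q.2

theorem graphResolvent_injective (hd : Dense (S.domain : Set E)) :
    Function.Injective (graphResolvent S) := by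
  refine (graphFst_injective S).comp ((injective_iff_map_eq_zero _).mpr fun w hw => ?_)
  refine (denseRange_graphFst hd).eq_zero_of_inner_left ℂ fun p => ?_
  have adjoint_eq_zero : (graphFst S).adjoint w = 0 := hw
  rw [← ContinuousLinearMap.adjoint_inner_left, adjoint_eq_zero, inner_zero_left]

theorem graphResolvent_nonneg : 0 ≤ graphResolvent S :=
  (ContinuousLinearMap.nonneg_iff_isPositive _).mpr
    (ContinuousLinearMap.isPositive_self_comp_adjoint _)

theorem graphResolvent_le_one : graphResolvent S ≤ 1 :=
  self_comp_adjoint_le_one (norm_graphFst_le S)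

theorem denseRange_adjoint_graphFst : DenseRange (graphFst S).adjoint := by
  refine (Submodule.dense_iff_topologicalClosure_eq_top
    (s := LinearMap.range (graphFst S).adjoint.toLinearMap)).mpr ?_
  rw [Submodule.topologicalClosure_eq_top_iff, ContinuousLinearMap.orthogonal_range,
    ContinuousLinearMap.adjoint_adjoint]
  exact LinearMap.ker_eq_bot.mpr (graphFst_injective S)

theorem mem_graph_adjoint_pcomp_self_iff (hd : Dense (S.domain : Set E)) {u a : E} :
    (u, a) ∈ (S.adjoint.pcomp S).graph ↔
      ∃ w, graphResolvent S w = u ∧ w - graphResolvent S w = a := by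
  rw [mem_graph_pcomp]
  constructor
  · rintro ⟨y, hy, hya⟩
    have adjoint_eq : (graphFst S).adjoint (u + a) = ⟨WithLp.toLp 2 (u, y), hy⟩ := by
      rw [adjoint_graphFst_eq_iff hd]
      simpa only [WithLp.toLp_fst, WithLp.toLp_snd, add_sub_cancel_left] using hya
    have resolvent_eq : graphResolvent S (u + a) = u := congrArg (graphFst S) adjoint_eq
    exact ⟨u + a, resolvent_eq, by rw [resolvent_eq, add_sub_cancel_left]⟩
  · rintro ⟨w, rfl, rfl⟩
    exact ⟨_, ((graphFst S).adjoint w).2, (adjoint_graphFst_eq_iff hd).mp rfl⟩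

theorem adjoint_pcomp_self_eq_quotientOp (hd : Dense (S.domain : Set E)) :
    S.adjoint.pcomp S = quotientOp (graphResolvent S) (1 - graphResolvent S) := by
  refine eq_of_eq_graph ?_
  ext ⟨u, a⟩
  rw [mem_graph_adjoint_pcomp_self_iff hd, mem_graph_quotientOp (graphResolvent_injective hd)]
  rfl

end Resolvent

variable [CompleteSpace F] [CompleteSpace G] {T : E →ₗ.[ℂ] G}

theorem exists_sqrt_adjoint_pcomp_self (hd : Dense (S.domain : Set E)) (hS : S.IsClosed) :
    (S.adjoint.pcomp S).IsPosSelfAdjoint ∧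
      ∃ B : E →ₗ.[ℂ] E, B.IsPosSelfAdjoint ∧ B.pcomp B = S.adjoint.pcomp S := by
  have := completeSpace_hilbertSumSubmodule hS
  rw [adjoint_pcomp_self_eq_quotientOp hd]
  exact exists_sqrt_quotientOp (graphResolvent_injective hd) graphResolvent_nonneg
    (sub_nonneg.mpr graphResolvent_le_one) (add_sub_cancel _ _)

theorem graph_eq_closure_graph_domRestrict (hd : Dense (S.domain : Set E)) (hS : S.IsClosed) :
    S.graph = (S.domRestrict (S.adjoint.pcomp S).domain).graph.topologicalClosure := by
  have := completeSpace_hilbertSumSubmodule hS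
  refine le_antisymm (fun p hp => ?_) <|
    Submodule.topologicalClosure_minimal _ (LinearPMap.le_graph_of_le S.domRestrict_le) hS
  have cont : Continuous fun q : hilbertSumSubmodule S.graph => (q.1.fst, q.1.snd) :=
    (WithLp.prodContinuousLinearEquiv 2 ℂ E F).continuous.comp continuous_subtype_val
  refine (denseRange_adjoint_graphFst (S := S)).induction_on (b₀ := ⟨WithLp.toLp 2 p, hp⟩)
    (p := fun q => (q.1.fst, q.1.snd) ∈ _)
    ((Submodule.isClosed_topologicalClosure _).preimage cont) fun w => ?_
  refine Submodule.le_topologicalClosure _ ?_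
  obtain ⟨u, hu, hSu⟩ := (mem_graph_iff S).mp ((graphFst S).adjoint w).2
  have mem_domain : (u : E) ∈ (S.adjoint.pcomp S).domain := mem_domain_of_mem_graph <|
    (mem_graph_adjoint_pcomp_self_iff hd).mpr ⟨w, hu.symm, rfl⟩
  exact (mem_graph_iff _).mpr ⟨⟨u, mem_domain, u.2⟩, hu,
    (LinearPMap.domRestrict_apply rfl).trans hSu⟩

theorem ofOp_eq_of_adjoint_pcomp_self_eq (hd : Dense (S.domain : Set E)) (hS : S.IsClosed)
    (hd' : Dense (T.domain : Set E)) (hT : T.IsClosed)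
    (h : S.adjoint.pcomp S = T.adjoint.pcomp T)
    (hdom : Dense ((S.adjoint.pcomp S).domain : Set E)) :
    PosForm.ofOp S hd = PosForm.ofOp T hd' := by
  have domain_eq : (S.domRestrict (S.adjoint.pcomp S).domain).domain =
      (S.adjoint.pcomp S).domain := inf_eq_left.mpr domain_adjoint_pcomp_self_le
  have domain_eq' : (T.domRestrict (T.adjoint.pcomp T).domain).domain =
      (S.adjoint.pcomp S).domain := by
    rw [h]
    exact inf_eq_left.mpr domain_adjoint_pcomp_self_le
  have hr : Dense ((S.domRestrict (S.adjoint.pcomp S).domain).domain : Set E) := by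
    rwa [domain_eq]
  have hr' : Dense ((T.domRestrict (T.adjoint.pcomp T).domain).domain : Set E) := by
    rwa [domain_eq']
  have restrict_eq : PosForm.ofOp _ hr = PosForm.ofOp _ hr' := by
    refine PosForm.ext_of_form (domain_eq.trans domain_eq'.symm) fun x y => ?_
    obtain ⟨z, hz⟩ : ∃ z, ((x : E), z) ∈ (S.adjoint.pcomp S).graph :=
      ⟨_, (S.adjoint.pcomp S).mem_graph ⟨x, domain_eq'.le x.2⟩⟩
    have hz' : ((x : E), z) ∈ (T.adjoint.pcomp T).graph := LinearPMap.le_graph_of_le h.le hz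
    exact (inner_eq_of_mem_graph_adjoint_pcomp_self hd (x := ⟨x, _⟩) hz ⟨y, _⟩).trans
      (inner_eq_of_mem_graph_adjoint_pcomp_self hd' (x := ⟨x, _⟩) hz' ⟨y, _⟩).symm
  have closure_S := PosForm.isClosureOf_ofOp hd hr (graph_eq_closure_graph_domRestrict hd hS)
  rw [restrict_eq] at closure_S
  exact closure_S.unique
    (PosForm.isClosureOf_ofOp hd' hr' (graph_eq_closure_graph_domRestrict hd' hT))

theorem isFormOf_ofOp (hd : Dense (S.domain : Set E)) (hS : S.IsClosed) :
    (PosForm.ofOp S hd).IsFormOf (S.adjoint.pcomp S) := by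
  obtain ⟨pos, B, hB, B_sq⟩ := exists_sqrt_adjoint_pcomp_self hd hS
  have sq_eq : S.adjoint.pcomp S = B.adjoint.pcomp B := by
    rw [isSelfAdjoint_def.mp hB.1, B_sq]
  rw [ofOp_eq_of_adjoint_pcomp_self_eq hd hS hB.1.dense_domain hB.1.isClosed sq_eq
    pos.1.dense_domain]
  exact ⟨pos, B, hB, B_sq, rfl, fun _ _ => rfl⟩

end VonNeumann

section SimonLebesgue

variable {E F G : Type*} [NormedAddCommGroup E] [InnerProductSpace ℂ E]
  [NormedAddCommGroup F] [InnerProductSpace ℂ F]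
  [NormedAddCommGroup G] [InnerProductSpace ℂ G]

theorem inner_starProjection_add_inner_starProjection_orthogonal (M : Submodule ℂ F)
    [M.HasOrthogonalProjection] (x y : F) :
    inner ℂ (M.starProjection x) (M.starProjection y) +
      inner ℂ (Mᗮ.starProjection x) (Mᗮ.starProjection y) = inner ℂ x y := by
  simp only [Submodule.inner_starProjection_left_eq_right,
    Submodule.starProjection_eq_self_iff.mpr (Submodule.starProjection_apply_mem _ _)]
  rw [← inner_add_right, Submodule.starProjection_add_starProjection_orthogonal]

variable {T : E →ₗ.[ℂ] F}

theorem PosForm.quad_ofOp_compPMap (hT : Dense (T.domain : Set E)) (A : F →L[ℂ] G) (u : T.domain) :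
    (ofOp (A.toLinearMap.compPMap T) hT).quad u = ‖A (T u)‖ ^ 2 :=
  quad_ofOp (A.toLinearMap.compPMap T) hT u

variable [CompleteSpace E]

theorem mem_graph_adjoint_compPMap [CompleteSpace F] [CompleteSpace G]
    (hT : Dense (T.domain : Set E)) (A : F →L[ℂ] G) {b : G} {a : E} :
    (b, a) ∈ (A.toLinearMap.compPMap T).adjoint.graph ↔ (A.adjoint b, a) ∈ T.adjoint.graph := by
  rw [adjoint_graph_eq_graph_adjoint hT,
    adjoint_graph_eq_graph_adjoint (T := A.toLinearMap.compPMap T) hT,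
    Submodule.mem_adjoint_iff, Submodule.mem_adjoint_iff]
  simp only [mem_graph_iff]
  constructor
  · rintro h _ _ ⟨v, rfl, rfl⟩
    rw [ContinuousLinearMap.adjoint_inner_right]
    exact h _ _ ⟨v, rfl, rfl⟩
  · rintro h _ _ ⟨v, rfl, rfl⟩
    have := h _ _ ⟨v, rfl, rfl⟩
    rwa [ContinuousLinearMap.adjoint_inner_right] at this

namespace PosForm

theorem exists_isClosureOf_ofOp [CompleteSpace F] (hT : Dense (T.domain : Set E))
    (hT' : Dense (T.adjoint.domain : Set F)) :
    ∃ q : PosForm E, q.IsClosureOf (ofOp T hT) ∧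
      q.IsFormOf (T.adjoint.pcomp T.adjoint.adjoint) := by
  have closed := LinearPMap.adjoint_isClosed hT
  have hT'' := dense_domain_adjoint hT' closed
  have isFormOf := isFormOf_ofOp hT'' (LinearPMap.adjoint_isClosed hT')
  rw [adjoint_adjoint_eq_self hT' closed] at isFormOf
  exact ⟨_, isClosureOf_ofOp hT'' hT (adjoint_adjoint_graph hT hT'), isFormOf⟩

end PosForm

variable [CompleteSpace F] {M : Submodule ℂ F} [M.HasOrthogonalProjection]

theorem starProjection_mem_closure_graph (hT : Dense (T.domain : Set E))
    (hM : T.adjoint.domain ≤ M) (u : T.domain) :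
    ((u : E), M.starProjection (T u)) ∈ T.graph.topologicalClosure := by
  refine (mem_closure_graph_iff hT).mpr fun b => ?_
  rw [← Submodule.inner_starProjection_left_eq_right,
    Submodule.starProjection_eq_self_iff.mpr (hM b.2)]
  exact LinearPMap.adjoint_isFormalAdjoint hT b u

theorem zero_mem_closure_graph_starProjection_orthogonal (hT : Dense (T.domain : Set E))
    (hM : T.adjoint.domain ≤ M) (u : E) :
    (u, 0) ∈ (Mᗮ.starProjection.toLinearMap.compPMap T).graph.topologicalClosure := by
  refine (mem_closure_graph_iff (T := Mᗮ.starProjection.toLinearMap.compPMap T) hT).mpr fun b => ?_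
  have mem_graph := (mem_graph_adjoint_compPMap hT _).mp (LinearPMap.mem_graph _ b)
  rw [(isSelfAdjoint_starProjection Mᗮ).adjoint_eq] at mem_graph
  have mem_M := hM (mem_domain_of_mem_graph mem_graph)
  have eq_zero : Mᗮ.starProjection (b : F) = 0 := inner_self_eq_zero.mp <|
    (Submodule.mem_orthogonal _ _).mp (Submodule.starProjection_apply_mem _ _) _ mem_M
  rw [T.adjoint.graph_fst_eq_zero_snd mem_graph eq_zero, inner_zero_left, inner_zero_right]

namespace PosForm

theorem isSimonLebesgue_ofOp (hT : Dense (T.domain : Set E)) (hM : T.adjoint.domain ≤ M)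
    (hcl : (ofOp (M.starProjection.toLinearMap.compPMap T) hT).Closeable) :
    (ofOp T hT).IsSimonLebesgue (ofOp (M.starProjection.toLinearMap.compPMap T) hT)
      (ofOp (Mᗮ.starProjection.toLinearMap.compPMap T) hT) where
  dom_ac := rfl
  dom_s := rfl
  add x y := (inner_starProjection_add_inner_starProjection_orthogonal M (T x) (T y)).symm
  closeable := hcl
  le := ⟨le_rfl, fun u => ((quad_ofOp_compPMap hT M.starProjection u).trans_le
    (pow_le_pow_left₀ (norm_nonneg _) (Submodule.norm_starProjection_apply_le _ _) 2)).trans_eq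
      (quad_ofOp T hT u).symm⟩
  maximal p hp hle := ⟨hle.1, fun u => (hp.quad_le_of_mem_closure_graph hle
    (starProjection_mem_closure_graph hT hM u)).trans_eq
      (quad_ofOp_compPMap hT M.starProjection u).symm⟩
  singular p hp hle := p.form_eq_zero_of_quad_eq_zero fun u => by
    have quad_le := hp.quad_le_of_mem_closure_graph hle
      (zero_mem_closure_graph_starProjection_orthogonal hT hM (u : E))
    rw [norm_zero, zero_pow two_ne_zero] at quad_le
    exact quad_le.antisymm (p.quad_nonneg u)

end PosForm

end SimonLebesgue

namespace PosKernel

variable {X : Type*}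

section GramKernel

theorem posSemidef_gram {F : Type*} [NormedAddCommGroup F] [InnerProductSpace ℂ F] (Φ : X → F) :
    (Matrix.gram ℂ Φ).PosSemidef := by
  refine ⟨Matrix.isHermitian_gram ℂ Φ, fun c => ?_⟩
  have sum_eq_inner : (c.sum fun x a => c.sum fun y b => star a * Matrix.gram ℂ Φ x y * b) =
      inner ℂ (Finsupp.linearCombination ℂ Φ c) (Finsupp.linearCombination ℂ Φ c) := by
    simp only [Finsupp.linearCombination_apply, Finsupp.sum, sum_inner, inner_sum,
      inner_smul_left, inner_smul_right, Matrix.gram_apply, Complex.star_def, Finset.mul_sum]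
    rw [Finset.sum_comm]
    exact Finset.sum_congr rfl fun x _ => Finset.sum_congr rfl fun y _ => by ring
  rw [sum_eq_inner, inner_self_eq_norm_sq_to_K]
  exact (Complex.zero_le_real.mpr (sq_nonneg _)).trans_eq (Complex.ofReal_pow _ _)

theorem denseRange_linearCombination_vec (k : PosKernel X) :
    DenseRange (Finsupp.linearCombination ℂ k.vec) := by
  have dense := k.dense_kernelSpan
  rwa [kernelSpan, ← Finsupp.range_linearCombination] at dense

theorem continuousLinearMap_ext_vec {k : PosKernel X} {F : Type*} [NormedAddCommGroup F]
    [NormedSpace ℂ F] {A B : k.H →L[ℂ] F} (h : ∀ x, A (k.vec x) = B (k.vec x)) : A = B :=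
  ContinuousLinearMap.ext_on k.dense_kernelSpan (Set.forall_mem_range.mpr h)

theorem kernelSpan_linearMap_ext {k : PosKernel X} {F : Type*} [AddCommGroup F] [Module ℂ F]
    {A B : k.kernelSpan →ₗ[ℂ] F}
    (h : ∀ x, A ⟨k.vec x, k.vec_mem_kernelSpan x⟩ = B ⟨k.vec x, k.vec_mem_kernelSpan x⟩) :
    A = B :=
  (Submodule.linearMap_eq_iff_of_eq_span A B rfl).mpr <| by
    rintro ⟨_, x, rfl⟩
    exact h x

variable {F : Type*} [NormedAddCommGroup F] [InnerProductSpace ℂ F]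

theorem norm_linearCombination_eq_of_gram (k : PosKernel X) {Φ : X → F}
    (h : ∀ x y, inner ℂ (Φ x) (Φ y) = k x y) (c : X →₀ ℂ) :
    ‖Finsupp.linearCombination ℂ Φ c‖ = ‖Finsupp.linearCombination ℂ k.vec c‖ := by
  simp only [norm_eq_sqrt_re_inner (𝕜 := ℂ), Finsupp.linearCombination_apply, Finsupp.sum,
    sum_inner, inner_sum, inner_smul_left, inner_smul_right, h, inner_vec_vec]

theorem exists_linearIsometry_of_gram [CompleteSpace F] (k : PosKernel X) {Φ : X → F}
    (h : ∀ x y, inner ℂ (Φ x) (Φ y) = k x y) :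
    ∃ J : k.H →ₗᵢ[ℂ] F, ∀ x, J (k.vec x) = Φ x := by
  have norm_eq := k.norm_linearCombination_eq_of_gram h
  let J := (Finsupp.linearCombination ℂ Φ).extendOfNorm (Finsupp.linearCombination ℂ k.vec)
  have J_eq (c : X →₀ ℂ) :
      J (Finsupp.linearCombination ℂ k.vec c) = Finsupp.linearCombination ℂ Φ c :=
    LinearMap.extendOfNorm_eq k.denseRange_linearCombination_vec
      ⟨1, fun c => (norm_eq c).trans_le (one_mul _).ge⟩ c
  have norm_J (f : k.H) : ‖J f‖ = ‖f‖ :=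
    k.denseRange_linearCombination_vec.induction_on (p := fun f => ‖J f‖ = ‖f‖) f
      (isClosed_eq J.continuous.norm continuous_norm) fun c => by rw [J_eq, norm_eq]
  refine ⟨⟨J.toLinearMap, norm_J⟩, fun x => ?_⟩
  have J_vec := J_eq (Finsupp.single x 1)
  rwa [Finsupp.linearCombination_single, Finsupp.linearCombination_single, one_smul, one_smul]
    at J_vec

end GramKernel

section Restrict

variable (k : PosKernel X) (M : Submodule ℂ k.H)

/-- The reproducing kernel `(x, y) ↦ ⟪P k_x, P k_y⟫` of the closed subspace `M` of `H(k)`, where `P`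
is the orthogonal projection onto `M`. -/
noncomputable def restrict [M.HasOrthogonalProjection] : PosKernel X where
  toFun := Matrix.gram ℂ fun x => M.starProjection (k.vec x)
  posSemidef := posSemidef_gram fun x => M.starProjection (k.vec x)

theorem restrict_add_restrict_orthogonal [M.HasOrthogonalProjection] (x y : X) :
    k x y = k.restrict M x y + k.restrict Mᗮ x y := by
  rw [← inner_vec_vec]
  exact (inner_starProjection_add_inner_starProjection_orthogonal M _ _).symm

variable {k} in
theorem FormDefined.restrict {K : PosKernel X} (h : k.FormDefined K) (M : Submodule ℂ k.H)
    [M.HasOrthogonalProjection] : (k.restrict M).FormDefined K := by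
  intro c hc y
  have eq_zero : Finsupp.linearCombination ℂ k.vec c = 0 := RKHS.ext fun z => by
    rw [linearCombination_apply_eq, h c hc, RKHS.coe_zero, Pi.zero_apply]
  calc c.sum (fun x a => a * k.restrict M y x)
      = inner ℂ (M.starProjection (k.vec y))
          (M.starProjection (Finsupp.linearCombination ℂ k.vec c)) := by
        simp only [Finsupp.linearCombination_apply, Finsupp.sum, map_sum, map_smul, inner_sum,
          inner_smul_right]
        rfl
    _ = 0 := by rw [eq_zero, map_zero, inner_zero_right]

variable [M.HasOrthogonalProjection]

/-- The inclusion of `H(k.restrict M)` in `H(k)`, as spaces of functions. -/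
noncomputable def restrictIncl : (k.restrict M).H →ₗᵢ[ℂ] k.H :=
  ((k.restrict M).exists_linearIsometry_of_gram fun _ _ => rfl).choose

theorem restrictIncl_vec (x : X) :
    k.restrictIncl M ((k.restrict M).vec x) = M.starProjection (k.vec x) :=
  ((k.restrict M).exists_linearIsometry_of_gram fun _ _ => rfl).choose_spec x

theorem starProjection_restrictIncl (f : (k.restrict M).H) :
    M.starProjection (k.restrictIncl M f) = k.restrictIncl M f := by
  have comp_eq : M.starProjection ∘L (k.restrictIncl M).toContinuousLinearMap =
      (k.restrictIncl M).toContinuousLinearMap := continuousLinearMap_ext_vec fun x => by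
    rw [ContinuousLinearMap.comp_apply, LinearIsometry.coe_toContinuousLinearMap, restrictIncl_vec]
    exact Submodule.starProjection_eq_self_iff.mpr (Submodule.starProjection_apply_mem _ _)
  exact DFunLike.congr_fun comp_eq f

theorem restrictIncl_apply (f : (k.restrict M).H) (x : X) : k.restrictIncl M f x = f x := by
  rw [← inner_vec, ← starProjection_restrictIncl, ← Submodule.inner_starProjection_left_eq_right,
    ← restrictIncl_vec, LinearIsometry.inner_map_map, inner_vec]

theorem restrictIncl_adjoint (f : k.H) :
    k.restrictIncl M ((k.restrictIncl M).toContinuousLinearMap.adjoint f) =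
      M.starProjection f := by
  have adjoint_vec (x : X) :
      (k.restrictIncl M).toContinuousLinearMap.adjoint (k.vec x) = (k.restrict M).vec x := by
    refine ext_inner_right ℂ fun g => ?_
    rw [ContinuousLinearMap.adjoint_inner_left, inner_vec, inner_vec]
    exact k.restrictIncl_apply M g x
  have comp_eq : (k.restrictIncl M).toContinuousLinearMap ∘L
      (k.restrictIncl M).toContinuousLinearMap.adjoint = M.starProjection :=
    continuousLinearMap_ext_vec fun x => by
      rw [ContinuousLinearMap.comp_apply, adjoint_vec, LinearIsometry.coe_toContinuousLinearMap,
        restrictIncl_vec]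
  exact DFunLike.congr_fun comp_eq f

theorem range_restrictIncl : LinearMap.range (k.restrictIncl M).toLinearMap = M := by
  refine le_antisymm ?_ fun f hf => ?_
  · rintro _ ⟨f, rfl⟩
    exact Submodule.starProjection_eq_self_iff.mp (k.starProjection_restrictIncl M f)
  · exact ⟨_, (k.restrictIncl_adjoint M f).trans (Submodule.starProjection_eq_self_iff.mpr hf)⟩

end Restrict

section Transfer

variable {k K : PosKernel X} (h : k.FormDefined K)

variable (k K) in
/-- The operator `K_x ↦ k_x` from `H(K)` to `H(k)`, with domain the span of the vectors `K_x`. -/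
noncomputable def transferOp : K.H →ₗ.[ℂ] k.H :=
  ⟨K.kernelSpan, transfer k K h⟩

theorem kernelForm_eq_ofOp :
    k.kernelForm K h = PosForm.ofOp (transferOp k K h) K.dense_kernelSpan := rfl

theorem restrictIncl_transfer (M : Submodule ℂ k.H) [M.HasOrthogonalProjection]
    (u : K.kernelSpan) : k.restrictIncl M (transfer (k.restrict M) K (h.restrict M) u) =
      M.starProjection (transfer k K h u) := by
  have comp_eq : (k.restrictIncl M).toLinearMap ∘ₗ transfer (k.restrict M) K (h.restrict M) =
      M.starProjection.toLinearMap ∘ₗ transfer k K h := kernelSpan_linearMap_ext fun x => by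
    rw [LinearMap.comp_apply, LinearMap.comp_apply, transfer_vec, transfer_vec]
    exact k.restrictIncl_vec M x
  exact DFunLike.congr_fun comp_eq u

theorem kernelForm_restrict (M : Submodule ℂ k.H) [M.HasOrthogonalProjection] :
    (k.restrict M).kernelForm K (h.restrict M) =
      PosForm.ofOp (M.starProjection.toLinearMap.compPMap (transferOp k K h))
        K.dense_kernelSpan := by
  refine PosForm.ext_of_form rfl fun u v => ?_
  exact ((k.restrictIncl M).inner_map_map _ _).symm.trans
    (congrArg₂ (inner ℂ) (restrictIncl_transfer h M u) (restrictIncl_transfer h M v))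

theorem adjoint_graph_transferOp : (transferOp k K h).adjoint.graph = sameFun k K := by
  rw [adjoint_graph_eq_graph_adjoint (T := transferOp k K h) K.dense_kernelSpan]
  ext ⟨b, a⟩
  rw [Submodule.mem_adjoint_iff]
  simp only [sub_eq_zero]
  constructor
  · intro hab x
    have mem_graph : (K.vec x, k.vec x) ∈ (transferOp k K h).graph :=
      (mem_graph_iff _).mpr ⟨⟨K.vec x, K.vec_mem_kernelSpan x⟩, rfl, transfer_vec k K h x⟩
    simpa only [inner_vec] using hab _ _ mem_graph
  · rintro hab _ _ huv
    obtain ⟨u, rfl, rfl⟩ := (mem_graph_iff _).mp huv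
    have inner_eq : (innerSL ℂ b).toLinearMap ∘ₗ transfer k K h =
        (innerSL ℂ a).toLinearMap ∘ₗ K.kernelSpan.subtype := kernelSpan_linearMap_ext fun x => by
      simp only [LinearMap.comp_apply, ContinuousLinearMap.coe_coe, innerSL_apply_apply,
        Submodule.subtype_apply]
      rw [transfer_vec, ← inner_conj_symm, inner_vec, ← inner_conj_symm a, inner_vec]
      exact congrArg _ (hab x)
    have inner_apply_eq : inner ℂ b (transfer k K h u) = inner ℂ a (u : K.H) :=
      DFunLike.congr_fun inner_eq u
    exact (inner_conj_symm _ _).symm.trans <|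
      (congrArg (starRingEnd ℂ) inner_apply_eq).trans (inner_conj_symm _ _)

theorem adjoint_domain_transferOp : (transferOp k K h).adjoint.domain = k.inter K := by
  rw [← LinearPMap.graph_map_fst_eq_domain, adjoint_graph_transferOp]
  rfl

end Transfer

section Embedding

variable (k K : PosKernel X)

theorem isClosed_sameFun : IsClosed (sameFun k K : Set (k.H × K.H)) := by
  have eq_iInter : (sameFun k K : Set (k.H × K.H)) = ⋂ x, {p | p.1 x = p.2 x} := by
    ext p
    rw [Set.mem_iInter]
    rfl
  rw [eq_iInter]
  exact isClosed_iInter fun x => isClosed_eq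
    ((RKHS.continuous_eval (𝕜 := ℂ) x).comp continuous_fst)
    ((RKHS.continuous_eval (𝕜 := ℂ) x).comp continuous_snd)

theorem mem_graph_embedding {f : k.interClosure K} {g : K.H} :
    (f, g) ∈ (k.embedding K).graph ↔ ((f : k.H), g) ∈ sameFun k K := by
  rw [embedding, Submodule.toLinearPMap_graph_eq]
  · rfl
  · intro p hp hp0
    refine RKHS.ext fun y => ?_
    rw [← show (p.1 : k.H) y = p.2 y from hp y, hp0, Submodule.coe_zero, RKHS.coe_zero,
      RKHS.coe_zero]

theorem isClosed_embedding : (k.embedding K).IsClosed := by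
  have graph_eq : ((k.embedding K).graph : Set (k.interClosure K × K.H)) =
      Prod.map Subtype.val id ⁻¹' (sameFun k K : Set (k.H × K.H)) := by
    ext p
    exact k.mem_graph_embedding K
  rw [LinearPMap.IsClosed, graph_eq]
  exact (k.isClosed_sameFun K).preimage (continuous_subtype_val.prodMap continuous_id)

theorem dense_domain_embedding : Dense ((k.embedding K).domain : Set (k.interClosure K)) := by
  intro f
  rw [closure_subtype]
  refine closure_mono (fun g hg => ?_) f.2
  exact ⟨⟨g, (k.inter K).le_topologicalClosure hg⟩, (mem_embedding_domain k K _).mpr hg, rfl⟩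

variable {k K} in
theorem adjoint_orthogonalProjectionOnto_compPMap_transferOp (h : k.FormDefined K) :
    ((k.interClosure K).orthogonalProjectionOnto.toLinearMap.compPMap (transferOp k K h)).adjoint =
      k.embedding K := by
  refine eq_of_eq_graph ?_
  ext ⟨b, a⟩
  rw [mem_graph_adjoint_compPMap (T := transferOp k K h) K.dense_kernelSpan,
    adjoint_graph_transferOp, Submodule.adjoint_orthogonalProjectionOnto, mem_graph_embedding,
    Submodule.subtypeL_apply]

end Embedding

variable {k K : PosKernel X} (h : k.FormDefined K)

theorem exists_isClosureOf_kernelForm_restrict :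
    ∃ q : PosForm K.H,
      q.IsClosureOf ((k.restrict (k.interClosure K)).kernelForm K (h.restrict _)) ∧
      q.IsFormOf ((k.embedding K).pcomp (k.embedding K).adjoint) := by
  have adjoint_eq := adjoint_orthogonalProjectionOnto_compPMap_transferOp h
  have dense_adjoint := k.dense_domain_embedding K
  rw [← adjoint_eq] at dense_adjoint ⊢
  rw [kernelForm_restrict h]
  exact PosForm.exists_isClosureOf_ofOp
    (T := (k.interClosure K).orthogonalProjectionOnto.toLinearMap.compPMap (transferOp k K h))
    K.dense_kernelSpan dense_adjoint

theorem isSimonLebesgue_kernelForm_restrict :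
    (k.kernelForm K h).IsSimonLebesgue
      ((k.restrict (k.interClosure K)).kernelForm K (h.restrict _))
      ((k.restrict (k.interClosure K)ᗮ).kernelForm K (h.restrict _)) := by
  have closeable : PosForm.Closeable
      ((k.restrict (k.interClosure K)).kernelForm K (h.restrict _)) := by
    obtain ⟨q, hq, -⟩ := exists_isClosureOf_kernelForm_restrict h
    exact ⟨q, hq.1, hq.2.1⟩
  rw [kernelForm_restrict h] at closeable ⊢
  rw [kernelForm_restrict h, kernelForm_eq_ofOp]
  exact PosForm.isSimonLebesgue_ofOp _
    ((adjoint_domain_transferOp h).trans_le (k.inter K).le_topologicalClosure) closeable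

end PosKernel

theorem theoremA1 {X : Type*} (k K : PosKernel X) (hk : k.FormDefined K) :
    (∃ q_ac q_s : PosForm K.H, (k.kernelForm K hk).IsSimonLebesgue q_ac q_s) ∧
    ∀ q_ac q_s : PosForm K.H, (k.kernelForm K hk).IsSimonLebesgue q_ac q_s →
      ∃ (k_ac k_s : PosKernel X) (h_ac : k_ac.FormDefined K) (h_s : k_s.FormDefined K),
        q_ac = k_ac.kernelForm K h_ac ∧
        q_s = k_s.kernelForm K h_s ∧
        (∀ x y, k x y = k_ac x y + k_s x y) ∧
        (∃ (J_ac : k_ac.H →ₗᵢ[ℂ] k.H) (J_s : k_s.H →ₗᵢ[ℂ] k.H),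
          (∀ f x, J_ac f x = f x) ∧
          (∀ f x, J_s f x = f x) ∧
          LinearMap.range J_ac.toLinearMap ⟂ LinearMap.range J_s.toLinearMap ∧
          LinearMap.range J_ac.toLinearMap ⊔ LinearMap.range J_s.toLinearMap = ⊤ ∧
          LinearMap.range J_ac.toLinearMap = k.interClosure K) ∧
        Dense ((k.embedding K).domain : Set (k.interClosure K)) ∧
        (k.embedding K).IsClosed ∧
        ∃ q : PosForm K.H, q.IsClosureOf q_ac ∧
          q.IsFormOf ((k.embedding K).pcomp (k.embedding K).adjoint) := by
  have decomposition := PosKernel.isSimonLebesgue_kernelForm_restrict hk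
  refine ⟨⟨_, _, decomposition⟩, fun q_ac q_s hq => ?_⟩
  obtain ⟨rfl, rfl⟩ := decomposition.unique hq
  refine ⟨_, _, hk.restrict _, hk.restrict _, rfl, rfl, k.restrict_add_restrict_orthogonal _,
    ⟨k.restrictIncl _, k.restrictIncl _, k.restrictIncl_apply _, k.restrictIncl_apply _,
      ?_, ?_, k.range_restrictIncl _⟩,
    k.dense_domain_embedding K, k.isClosed_embedding K,
    PosKernel.exists_isClosureOf_kernelForm_restrict hk⟩
  · rw [k.range_restrictIncl, k.range_restrictIncl]
    exact Submodule.isOrtho_orthogonal_right _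
  · rw [k.range_restrictIncl, k.range_restrictIncl]
    exact Submodule.sup_orthogonal_of_hasOrthogonalProjection
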